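/- Let $\Omega$ be a thick Euclidean building with set of apartments $\mathcal A$, that is: $\Omega$ is an (abstract) simplicial complex (with faces the nonempty simplices, ordered by inclusion) and $\mathcal A$ is a set of subcomplexes covering $\Omega$, such that - every $\Sigma\in\mathcal A$ is a Euclidean Coxeter complex, i.e. it is isomorphic to the simplicial complex $\Sigma(W,V)$ whose simplices are the cells cut out in a Euclidean space $V$ by the reflection hyperplanes of an essential irreducible infinite affine reflection group $W$ on $V$; - any two faces of $\Omega$ lie in a common apartment; - if two apartments $\Sigma,\Sigma'$ both contain the faces $S_1,S_2$, there is a poset isomorphism $\Sigma\to\Sigma'$ which fixes every face of $S_1$ and every face of $S_2$; - (thickness) every face of codimension $1$ is contained in at least three chambers (maximal faces). Let $|\Omega|$ be the geometric realisation of $\Omega$, i.e. the set of formal sums $\sum_v\lambda_v v$ with $\lambda_v\ge 0$, $\sum_v\lambda_v=1$, whose vertices with $\lambda_v\neq 0$ form a face of $\Omega$. It carries its canonical affine structure: for $x,y\in|\Omega|$ and $t\in[0,1]$, the point $tx+(1-t)y$ is formed in $|\Sigma|\cong V$ for an apartment $\Sigma\cong\Sigma(W,V)$ with $x,y\in|\Sigma|$.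 Then every affine functional on $|\Omega|$ is constant: if $a:|\Omega|\to\mathbb R$ satisfies $$a(tx+(1-t)y)=t\,a(x)+(1-t)\,a(y)\qquad\text{for all }x,y\in|\Omega|,\ t\in[0,1],$$ then $a$ is constant. -/

import Mathlib

namespace EuclBuilding

/-! ### Affine reflection groups and their cells -/

/-- An (affine) hyperplane of `ℝⁿ`. -/
def IsHyperplane {n : ℕ} (H : AffineSubspace ℝ (EuclideanSpace ℝ (Fin n))) : Prop :=
  (H : Set (EuclideanSpace ℝ (Fin n))).Nonempty ∧ Module.finrank ℝ H.direction + 1 = n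

/-- The hyperplanes `H` whose orthogonal reflection belongs to the group `W` of affine isometries
of `ℝⁿ`. -/
def mirrors {n : ℕ} (W : Subgroup (EuclideanSpace ℝ (Fin n) ≃ᵃⁱ[ℝ] EuclideanSpace ℝ (Fin n))) :
    Set (AffineSubspace ℝ (EuclideanSpace ℝ (Fin n))) :=
  {H | IsHyperplane H ∧ ∃ _ : Nonempty H, EuclideanGeometry.reflection H ∈ W}

/-- `W` is an affine reflection group: it is generated by reflections in hyperplanes, and its
set of reflection hyperplanes (which is automatically stable under `W`) is locally finite. -/
structure IsAffineReflectionGroup {n : ℕ}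
    (W : Subgroup (EuclideanSpace ℝ (Fin n) ≃ᵃⁱ[ℝ] EuclideanSpace ℝ (Fin n))) : Prop where
  generated : W = Subgroup.closure
    {g | ∃ H ∈ mirrors W, ∃ _ : Nonempty H, g = EuclideanGeometry.reflection H}
  locallyFinite : ∀ x : EuclideanSpace ℝ (Fin n), ∃ U ∈ nhds x,
    {H | H ∈ mirrors W ∧ ((H : Set (EuclideanSpace ℝ (Fin n))) ∩ U).Nonempty}.Finite

/-- `W` is essential: the linear parts of its elements have no common nonzero fixed vector. -/
def IsEssential {n : ℕ}
    (W : Subgroup (EuclideanSpace ℝ (Fin n) ≃ᵃⁱ[ℝ] EuclideanSpace ℝ (Fin n))) : Prop :=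
  ∀ v : EuclideanSpace ℝ (Fin n), (∀ g ∈ W, g.linearIsometryEquiv v = v) → v = 0

/-- `W` is irreducible: the group of linear parts of its elements leaves no linear subspace other
than `0` and `ℝⁿ` invariant. -/
def IsIrreducible {n : ℕ}
    (W : Subgroup (EuclideanSpace ℝ (Fin n) ≃ᵃⁱ[ℝ] EuclideanSpace ℝ (Fin n))) : Prop :=
  ∀ U : Submodule ℝ (EuclideanSpace ℝ (Fin n)),
    (∀ g ∈ W, ∀ u ∈ U, g.linearIsometryEquiv u ∈ U) → U = ⊥ ∨ U = ⊤

/-- Essential irreducible infinite affine reflection groups. -/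
structure IsEuclideanReflectionGroup {n : ℕ}
    (W : Subgroup (EuclideanSpace ℝ (Fin n) ≃ᵃⁱ[ℝ] EuclideanSpace ℝ (Fin n))) : Prop where
  reflectionGroup : IsAffineReflectionGroup W
  essential : IsEssential W
  irreducible : IsIrreducible W
  infinite : Infinite W

/-- The cells of `W`: the classes of points which, for every reflection hyperplane `H` of `W`,
either all lie on `H` or all lie strictly on the same side of `H`. -/
def IsCell {n : ℕ} (W : Subgroup (EuclideanSpace ℝ (Fin n) ≃ᵃⁱ[ℝ] EuclideanSpace ℝ (Fin n)))
    (A : Set (EuclideanSpace ℝ (Fin n))) : Prop :=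
  ∃ x, A = {y | ∀ H ∈ mirrors W, (x ∈ H ∧ y ∈ H) ∨ H.SSameSide x y}

/-! ### Euclidean Coxeter complexes -/

/-- The set of convex combinations with positive coefficients of the points `φ v`, `v ∈ s`. -/
def openSimplex {X : Type*} {n : ℕ} (φ : X → EuclideanSpace ℝ (Fin n)) (s : Finset X) :
    Set (EuclideanSpace ℝ (Fin n)) :=
  {y | ∃ w : X → ℝ, (∀ v ∈ s, 0 < w v) ∧ ∑ v ∈ s, w v = 1 ∧ y = ∑ v ∈ s, w v • φ v}

/-- `φ`, a map from the vertices to `ℝⁿ`, gives an isomorphism from the simplicial complex `K` onto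
the simplicial complex `Σ(W, ℝⁿ)`, whose simplices are the cells of `W`: the vertices of every
simplex `s` of `K` go to the vertices of a (nondegenerate) simplex whose relative interior is a
cell, and each cell comes from exactly one `s`. (The values of `φ` at points of `X` that are not
vertices of `K` play no role.) -/
structure IsChart {X : Type*} {n : ℕ} (K : PreAbstractSimplicialComplex X)
    (W : Subgroup (EuclideanSpace ℝ (Fin n) ≃ᵃⁱ[ℝ] EuclideanSpace ℝ (Fin n)))
    (φ : X → EuclideanSpace ℝ (Fin n)) : Prop where
  affineIndependent : ∀ s ∈ K, AffineIndependent ℝ (fun v : s => φ v)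
  isCell : ∀ s ∈ K, IsCell W (openSimplex φ s)
  existsUnique : ∀ A, IsCell W A → ∃! s, s ∈ K ∧ openSimplex φ s = A

/-- `K` is a Euclidean Coxeter complex: it is isomorphic to `Σ(W, V)` for an essential irreducible
infinite affine reflection group `(W, V)`. -/
def IsEuclideanCoxeterComplex {X : Type*} (K : PreAbstractSimplicialComplex X) : Prop :=
  ∃ (n : ℕ) (W : Subgroup (EuclideanSpace ℝ (Fin n) ≃ᵃⁱ[ℝ] EuclideanSpace ℝ (Fin n)))
    (φ : X → EuclideanSpace ℝ (Fin n)), IsEuclideanReflectionGroup W ∧ IsChart K W φ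

/-! ### Euclidean buildings -/

/-- `Ω` with the set `𝒜` of apartments is a Euclidean building. -/
structure IsEuclideanBuilding {X : Type*} (Ω : PreAbstractSimplicialComplex X)
    (𝒜 : Set (PreAbstractSimplicialComplex X)) : Prop where
  subcomplex : ∀ K ∈ 𝒜, K ≤ Ω
  cover : ∀ s ∈ Ω, ∃ K ∈ 𝒜, s ∈ K
  apartment : ∀ K ∈ 𝒜, IsEuclideanCoxeterComplex K
  exists_apartment : ∀ s ∈ Ω, ∀ t ∈ Ω, ∃ K ∈ 𝒜, s ∈ K ∧ t ∈ K
  /-- If two apartments both contain the faces `s` and `t`, there is a poset isomorphism between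
  them that fixes every face of `s` and every face of `t`. -/
  exists_iso : ∀ K ∈ 𝒜, ∀ L ∈ 𝒜, ∀ s t : Finset X, s ∈ K → t ∈ K → s ∈ L → t ∈ L →
    ∃ e : K.faces ≃o L.faces,
      ∀ u : K.faces, ((u : Finset X) ⊆ s ∨ (u : Finset X) ⊆ t) → (e u : Finset X) = u

/-- The chambers are the maximal faces. -/
def IsChamber {X : Type*} (Ω : PreAbstractSimplicialComplex X) (C : Finset X) : Prop :=
  C ∈ Ω ∧ ∀ s ∈ Ω, C ⊆ s → s = C

/-- Every face of codimension one is a face of at least three chambers. -/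
def IsThick {X : Type*} (Ω : PreAbstractSimplicialComplex X) : Prop :=
  ∀ S ∈ Ω, (∃ C, IsChamber Ω C ∧ S ⊆ C ∧ C.card = S.card + 1) →
    3 ≤ {C | IsChamber Ω C ∧ S ⊆ C}.encard

/-! ### The geometric realisation and its affine structure -/

/-- The geometric realisation: formal convex combinations of vertices, whose vertices with nonzero
coefficient form a face. -/
def Realisation {X : Type*} (Ω : PreAbstractSimplicialComplex X) : Type _ :=
  {p : X →₀ ℝ // p.support ∈ Ω ∧ (∀ v, 0 ≤ p v) ∧ (p.sum fun _ a => a) = 1}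

/-- The map `∑ λ_v v ↦ ∑ λ_v φ(v)` induced on realisations by a vertex map `φ` into `ℝⁿ`. -/
noncomputable def chartMap {X : Type*} {n : ℕ} (φ : X → EuclideanSpace ℝ (Fin n))
    {Ω : PreAbstractSimplicialComplex X} (x : Realisation Ω) : EuclideanSpace ℝ (Fin n) :=
  x.1.sum fun v a => a • φ v

/-- The graph of the canonical affine structure of `|Ω|`: the relation `z = t x + (1 - t) y`. The
points lie in the realisation of a common apartment `K`, and the relation holds there after an
identification of `K` with `Σ(W, V)`, in the Euclidean space `V`. -/
def IsConvexCombination {X : Type*} (Ω : PreAbstractSimplicialComplex X)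
    (𝒜 : Set (PreAbstractSimplicialComplex X)) (t : ℝ) (x y z : Realisation Ω) : Prop :=
  ∃ K ∈ 𝒜, x.1.support ∈ K ∧ y.1.support ∈ K ∧ z.1.support ∈ K ∧
    ∃ (n : ℕ) (W : Subgroup (EuclideanSpace ℝ (Fin n) ≃ᵃⁱ[ℝ] EuclideanSpace ℝ (Fin n)))
      (φ : X → EuclideanSpace ℝ (Fin n)), IsEuclideanReflectionGroup W ∧ IsChart K W φ ∧
        chartMap φ z = t • chartMap φ x + (1 - t) • chartMap φ y

/-- Affine functionals: `f (t x + (1 - t) y) = t f(x) + (1 - t) f(y)` for `t ∈ [0, 1]`. -/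
def IsAffineFunctional {X : Type*} (Ω : PreAbstractSimplicialComplex X)
    (𝒜 : Set (PreAbstractSimplicialComplex X)) (f : Realisation Ω → ℝ) : Prop :=
  ∀ t ∈ Set.Icc (0 : ℝ) 1, ∀ x y z : Realisation Ω,
    IsConvexCombination Ω 𝒜 t x y z → f z = t * f x + (1 - t) * f y

end EuclBuilding

/-! In a chart of an apartment the functional is an affine function `A` on `ℝⁿ`
(`IsAffineFunctional.exists_affineMap`), and any two points of the realisation lie in a common
apartment. So it suffices that the linear part of `A` vanishes.

Thickness supplies this. Let `v₁`, `v₂`, `v₃` complete a panel `P` to three chambers. Two of these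
chambers lie in a common apartment, where the reflection in the wall spanned by `P` exchanges them
(`IsChart.reflection_panel`). If `q` is the foot of the perpendicular from `vᵢ` to the wall, then `f
vᵢ + f vⱼ = 2 f(q)`. The foot is recorded by its affine coordinates `b` with respect to `P`: these
survive the passage to another apartment, since charts can be chosen to agree on a common chamber
(`IsChart.transfer`), and they are the same for both chambers. Here `f(q)` stands for `∑ b p * f p`,
so `q` need not lie in `P`. The three equations for the three pairs give `f vᵢ = f(q)`
(`IsEuclideanBuilding.eq_sum_of_isFoot`).

Hence the gradient of `A` is orthogonal to the normals of all facets of a chamber. These normals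
span `ℝⁿ`, so the gradient is zero (`linear_eq_zero_of_isFoot`). -/

namespace EuclBuilding

open Module Topology

/-! ### Hyperplanes and their sides -/

section Hyperplanes

variable {n : ℕ}

local notation "E" => EuclideanSpace ℝ (Fin n)

/-- A hyperplane is the zero set of an affine function whose sign separates its two sides. -/
theorem IsHyperplane.exists_affineMap {H : AffineSubspace ℝ E} (hH : IsHyperplane H) :
    ∃ η : E →ᵃ[ℝ] ℝ, (∀ x, x ∈ H ↔ η x = 0) ∧ ∀ x y, H.SSameSide x y ↔ 0 < η x * η y := by
  obtain ⟨⟨q, hq⟩, hfr⟩ := hH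
  have h1 : finrank ℝ H.directionᗮ = 1 := by
    have := H.direction.finrank_add_finrank_orthogonal
    rw [finrank_euclideanSpace_fin] at this
    omega
  obtain ⟨⟨m, hm⟩, hm0, hspan⟩ := finrank_eq_one_iff'.1 h1
  have hm0' : m ≠ 0 := fun h => hm0 (Subtype.ext h)
  have hmm : inner ℝ m m ≠ 0 := inner_self_ne_zero.2 hm0'
  have hdir : ∀ v, v ∈ H.direction ↔ inner ℝ m v = 0 := by
    intro v
    constructor
    · intro hv
      exact (Submodule.mem_orthogonal' _ _).1 hm v hv
    · intro hv
      rw [← Submodule.orthogonal_orthogonal H.direction, Submodule.mem_orthogonal]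
      intro u hu
      obtain ⟨c, hc⟩ := hspan ⟨u, hu⟩
      have hc' : c • m = u := congrArg Subtype.val hc
      rw [← hc', inner_smul_left, hv, mul_zero]
  let η : E →ᵃ[ℝ] ℝ := (innerₛₗ ℝ m).toAffineMap - AffineMap.const ℝ E (inner ℝ m q)
  have hη : ∀ x, η x = inner ℝ m (x - q) := by
    intro x; simp [η, inner_sub_right]
  have hmem : ∀ x, x ∈ H ↔ η x = 0 := by
    intro x
    rw [hη, ← hdir, ← vsub_eq_sub, AffineSubspace.vsub_right_mem_direction_iff_mem hq]
  refine ⟨η, hmem, fun x y => ⟨?_, fun h => ?_⟩⟩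
  · rintro ⟨⟨p₁, hp₁, p₂, hp₂, hray⟩, hx, hy⟩
    have hx' : η x ≠ 0 := fun h => hx ((hmem x).2 h)
    have hy' : η y ≠ 0 := fun h => hy ((hmem y).2 h)
    have ex : ∀ z p, p ∈ H → η z = inner ℝ m (z -ᵥ p) := by
      intro z p hp
      have := (hmem p).1 hp
      rw [hη] at this ⊢
      rw [vsub_eq_sub, ← sub_sub_sub_cancel_right z p q, inner_sub_right m (z - q), this, sub_zero]
    rcases hray with h | h | ⟨r₁, r₂, hr₁, hr₂, h⟩
    · exact absurd (by rw [ex x p₁ hp₁, h, inner_zero_right]) hx'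
    · exact absurd (by rw [ex y p₂ hp₂, h, inner_zero_right]) hy'
    · have h2 : r₁ * η x = r₂ * η y := by
        rw [ex x p₁ hp₁, ex y p₂ hp₂, ← real_inner_smul_right, ← real_inner_smul_right, h]
      have h3 : 0 < r₂ * (η x * η y) := by
        have : r₂ * (η x * η y) = r₁ * (η x * η x) := by linear_combination -(η x) * h2
        rw [this]
        exact mul_pos hr₁ (mul_self_pos.2 hx')
      exact pos_of_mul_pos_right h3 hr₂.le
  · have hx' : η x ≠ 0 := fun h0 => by simp [h0] at h
    have hy' : η y ≠ 0 := fun h0 => by simp [h0] at h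
    have key : ∀ z, z - (η z / inner ℝ m m) • m ∈ H := by
      intro z
      rw [hmem, hη, sub_right_comm, inner_sub_right, inner_smul_right, ← hη]
      field_simp
      ring
    refine AffineSubspace.sSameSide_of_vsub_eq_smul (c₁ := η x / inner ℝ m m)
      (c₂ := η y / inner ℝ m m) (m := m) (key x) (key y) (by simp) (by simp) ?_
      (fun h0 => hx' ((hmem x).1 h0)) (fun h0 => hy' ((hmem y).1 h0))
    rw [div_mul_div_comm]
    exact div_nonneg h.le (mul_self_nonneg _)

/-- A hyperplane contained in a hyperplane is equal to it. -/
theorem IsHyperplane.eq_of_le {H H' : AffineSubspace ℝ E} (hH : IsHyperplane H)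
    (hH' : IsHyperplane H') (h : H ≤ H') : H = H' := by
  obtain ⟨q, hq⟩ := hH.1
  refine AffineSubspace.ext_of_direction_eq ?_ ⟨q, hq, h hq⟩
  refine Submodule.eq_of_le_of_finrank_eq (AffineSubspace.direction_le h) ?_
  have := hH.2
  have := hH'.2
  omega

theorem IsHyperplane.ne_top {H : AffineSubspace ℝ E} (hH : IsHyperplane H) : H ≠ ⊤ := by
  rintro rfl
  have := hH.2
  rw [AffineSubspace.direction_top, finrank_top, finrank_euclideanSpace_fin] at this
  omega

/-- The points of a convex set which does not meet a hyperplane lie on the same side of it. -/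
theorem IsHyperplane.sSameSide_of_convex {H : AffineSubspace ℝ E} (hH : IsHyperplane H)
    {U : Set E} (hU : Convex ℝ U) (hHU : ¬((H : Set E) ∩ U).Nonempty) {x y : E}
    (hx : x ∈ U) (hy : y ∈ U) : H.SSameSide x y := by
  obtain ⟨η, hmem, hside⟩ := hH.exists_affineMap
  rw [hside]
  by_contra hcon
  have hx0 : η x ≠ 0 := fun h => hHU ⟨x, (hmem x).2 h, hx⟩
  rcases eq_or_ne (η x) (η y) with h | h
  · rw [← h] at hcon
    exact hcon (mul_self_pos.2 hx0)
  · have hd : η x - η y ≠ 0 := sub_ne_zero.2 h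
    have hxy : η x * η y ≤ 0 := not_lt.1 hcon
    -- On the segment from `x` to `y`, `η` vanishes at this parameter. Multiplying by `η x - η y`
    -- avoids a case split on its sign.
    have h0 : 0 ≤ η x / (η x - η y) := by
      rw [← mul_div_mul_right _ _ hd]
      exact div_nonneg (by nlinarith [mul_self_nonneg (η x)]) (mul_self_nonneg _)
    have h1 : η x / (η x - η y) ≤ 1 := by
      rw [← mul_div_mul_right _ _ hd]
      rw [div_le_one (mul_self_pos.2 hd)]
      nlinarith [mul_self_nonneg (η y)]
    refine hHU ⟨AffineMap.lineMap x y (η x / (η x - η y)), (hmem _).2 ?_, ?_⟩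
    · rw [AffineMap.apply_lineMap, AffineMap.lineMap_apply_ring']
      field_simp
      ring
    · exact hU.segment_subset hx hy (by
        rw [segment_eq_image_lineMap]; exact ⟨_, ⟨h0, h1⟩, rfl⟩)

end Hyperplanes

/-! ### Mirrors and cells of a reflection group -/

section Cells

variable {n : ℕ} {W : Subgroup (EuclideanSpace ℝ (Fin n) ≃ᵃⁱ[ℝ] EuclideanSpace ℝ (Fin n))}

local notation "E" => EuclideanSpace ℝ (Fin n)

/-- The cell of `W` that contains the point `x`. -/
def cellOf (W : Subgroup (EuclideanSpace ℝ (Fin n) ≃ᵃⁱ[ℝ] EuclideanSpace ℝ (Fin n)))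
    (x : EuclideanSpace ℝ (Fin n)) : Set (EuclideanSpace ℝ (Fin n)) :=
  {y | ∀ H ∈ mirrors W, (x ∈ H ∧ y ∈ H) ∨ H.SSameSide x y}

theorem mem_cellOf_self (x : E) : x ∈ cellOf W x := by
  intro H hH
  by_cases hx : x ∈ H
  · exact Or.inl ⟨hx, hx⟩
  · exact Or.inr (AffineSubspace.sSameSide_self_iff.2 ⟨hH.1.1, hx⟩)

theorem mem_cellOf_symm {x y : E} (h : y ∈ cellOf W x) : x ∈ cellOf W y :=
  fun H hH => (h H hH).imp And.symm AffineSubspace.SSameSide.symm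

theorem mem_cellOf_trans {x y z : E} (h : y ∈ cellOf W x) (h' : z ∈ cellOf W y) :
    z ∈ cellOf W x := by
  intro H hH
  rcases h H hH with ⟨hx, hy⟩ | hxy
  · rcases h' H hH with ⟨_, hz⟩ | hyz
    · exact Or.inl ⟨hx, hz⟩
    · exact absurd hy hyz.left_notMem
  · rcases h' H hH with ⟨hy, _⟩ | hyz
    · exact absurd hy hxy.right_notMem
    · exact Or.inr (hxy.trans hyz)

theorem cellOf_eq_of_mem {x y : E} (h : y ∈ cellOf W x) : cellOf W y = cellOf W x :=
  Set.Subset.antisymm (fun _ hz => mem_cellOf_trans h hz)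
    (fun _ hz => mem_cellOf_trans (mem_cellOf_symm h) hz)

theorem IsCell.eq_cellOf {A : Set E} (hA : IsCell W A) {x : E} (hx : x ∈ A) :
    A = cellOf W x := by
  obtain ⟨y, rfl⟩ := hA
  exact (cellOf_eq_of_mem hx).symm

/-- Conjugating the reflection in `H` by `g` gives the reflection in `g H`. -/
theorem map_mem_mirrors {g : E ≃ᵃⁱ[ℝ] E} (hg : g ∈ W) {H : AffineSubspace ℝ E}
    (hH : H ∈ mirrors W) : H.map (g.toAffineEquiv : E →ᵃ[ℝ] E) ∈ mirrors W := by
  obtain ⟨⟨⟨q, hq⟩, hfr⟩, hne, hrefl⟩ := hH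
  have hq' : g q ∈ H.map (g.toAffineEquiv : E →ᵃ[ℝ] E) := ⟨q, hq, rfl⟩
  have hne' : Nonempty (H.map (g.toAffineEquiv : E →ᵃ[ℝ] E)) := ⟨⟨_, hq'⟩⟩
  refine ⟨⟨⟨_, hq'⟩, ?_⟩, hne', ?_⟩
  · rw [AffineSubspace.map_direction]
    exact (congrArg (· + 1)
      (LinearEquiv.finrank_map_eq g.toAffineEquiv.linear H.direction)).trans hfr
  · have : EuclideanGeometry.reflection (H.map (g.toAffineEquiv : E →ᵃ[ℝ] E)) =
        g * EuclideanGeometry.reflection H * g⁻¹ := by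
      ext1 x
      obtain ⟨y, rfl⟩ := g.surjective x
      have h1 : (g * EuclideanGeometry.reflection H * g⁻¹) (g y) =
          g (EuclideanGeometry.reflection H y) := by
        show g (EuclideanGeometry.reflection H (g.symm (g y))) = _
        rw [g.symm_apply_apply]
      rw [h1]
      exact EuclideanGeometry.reflection_map H g.toAffineIsometry y
    rw [this]
    exact W.mul_mem (W.mul_mem hg hrefl) (W.inv_mem hg)

/-- An element of `W` permutes the cells. -/
theorem map_mem_cellOf {g : E ≃ᵃⁱ[ℝ] E} (hg : g ∈ W) {x y : E} (h : y ∈ cellOf W x) :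
    g y ∈ cellOf W (g x) := by
  intro H hH
  have hmap : (H.map ((g⁻¹).toAffineEquiv : E →ᵃ[ℝ] E)).map (g.toAffineEquiv : E →ᵃ[ℝ] E) = H := by
    have hid : (g.toAffineEquiv : E →ᵃ[ℝ] E).comp ((g⁻¹).toAffineEquiv : E →ᵃ[ℝ] E) =
        AffineMap.id ℝ E := AffineMap.ext g.apply_symm_apply
    rw [AffineSubspace.map_map, hid, AffineSubspace.map_id]
  have := h _ (map_mem_mirrors (W.inv_mem hg) hH)
  rw [← hmap]
  rcases this with ⟨hx, hy⟩ | hs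
  · exact Or.inl ⟨⟨x, hx, rfl⟩, ⟨y, hy, rfl⟩⟩
  · exact Or.inr (g.toAffineEquiv.sSameSide_map_iff.2 hs)

theorem isClosed_mirror {H : AffineSubspace ℝ E} : IsClosed (H : Set E) :=
  H.closed_of_finiteDimensional

/-- Near a point `p`, the cells are cut out by the mirrors through `p`. -/
theorem exists_ball_mem_cellOf (hW : IsAffineReflectionGroup W) (p : E) :
    ∃ ε > 0, ∀ x ∈ Metric.ball p ε, ∀ y ∈ Metric.ball p ε,
      (∀ H ∈ mirrors W, p ∈ H → (x ∈ H ∧ y ∈ H) ∨ H.SSameSide x y) → y ∈ cellOf W x := by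
  obtain ⟨U, hU, hfin⟩ := hW.locallyFinite p
  -- Only finitely many mirrors meet `U`. Those that miss `p` are closed, so a small ball around `p`
  -- avoids them all.
  have h1 : (⋂ H ∈ {H | H ∈ mirrors W ∧ ((H : Set E) ∩ U).Nonempty}, {z : E | p ∈ H ∨ z ∉ H})
      ∈ 𝓝 p := by
    rw [Filter.biInter_mem hfin]
    intro H _
    by_cases hp : p ∈ H
    · simp [hp]
    · simp only [hp, false_or]
      exact (isClosed_mirror (H := H)).isOpen_compl.mem_nhds hp
  obtain ⟨ε, hε, hball⟩ := Metric.mem_nhds_iff.1 (Filter.inter_mem hU h1)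
  refine ⟨ε, hε, fun x hx y hy hxy H hH => ?_⟩
  by_cases hp : p ∈ H
  · exact hxy H hH hp
  · refine Or.inr (hH.1.sSameSide_of_convex (convex_ball p ε) ?_ hx hy)
    rintro ⟨z, hzH, hz⟩
    have h2 := hball hz
    have h3 := Set.mem_iInter₂.1 h2.2 H ⟨hH, z, hzH, h2.1⟩
    exact h3.elim hp (fun h => h hzH)

/-- Some point lies on no mirror. -/
theorem exists_notMem_mirrors (hW : IsAffineReflectionGroup W) :
    ∃ x : E, ∀ H ∈ mirrors W, x ∉ H := by
  obtain ⟨U, hU, hfin⟩ := hW.locallyFinite 0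
  by_contra! hcon
  -- Otherwise finitely many hyperplanes, a null set, would cover a neighbourhood of `0`.
  have hsub : U ⊆ ⋃ H ∈ {H | H ∈ mirrors W ∧ ((H : Set E) ∩ U).Nonempty}, (H : Set E) := by
    intro x hx
    obtain ⟨H, hH, hxH⟩ := hcon x
    exact Set.mem_biUnion (show H ∈ _ from ⟨hH, x, hxH, hx⟩) hxH
  have h0 : MeasureTheory.volume U = 0 := by
    refine MeasureTheory.measure_mono_null hsub ?_
    rw [MeasureTheory.measure_biUnion_null_iff hfin.countable]
    exact fun H hH => MeasureTheory.Measure.addHaar_affineSubspace _ H hH.1.1.ne_top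
  exact (MeasureTheory.Measure.measure_pos_of_mem_nhds _ hU).ne' h0

end Cells

/-! ### Open simplices and their closures -/

section Simplices

variable {X : Type*} {n : ℕ} {φ : X → EuclideanSpace ℝ (Fin n)}

local notation "E" => EuclideanSpace ℝ (Fin n)

theorem openSimplex_subset_convexHull (s : Finset X) :
    openSimplex φ s ⊆ convexHull ℝ (φ '' s) := by
  rintro y ⟨w, hw, hw1, rfl⟩
  exact (convex_convexHull ℝ _).sum_mem (fun v hv => (hw v hv).le) hw1
    (fun v hv => subset_convexHull ℝ _ ⟨v, hv, rfl⟩)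

theorem openSimplex_nonempty {s : Finset X} (hs : s.Nonempty) : (openSimplex φ s).Nonempty := by
  have : (s.card : ℝ) ≠ 0 := by simpa using hs.ne_empty
  have hpos : (0 : ℝ) < s.card := by exact_mod_cast hs.card_pos
  refine ⟨_, fun _ => (s.card : ℝ)⁻¹, fun v _ => inv_pos.2 hpos, ?_, rfl⟩
  rw [Finset.sum_const, nsmul_eq_mul, mul_inv_cancel₀ this]

/-- Small `t` gives points of a chamber close to its panel; `t → 1` exhibits the opposite vertex as
a limit. -/
theorem lineMap_mem_openSimplex_insert [DecidableEq X] {P : Finset X} {v : X} (hv : v ∉ P) {p : E}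
    (hp : p ∈ openSimplex φ P) {t : ℝ} (ht0 : 0 < t) (ht1 : t < 1) :
    AffineMap.lineMap p (φ v) t ∈ openSimplex φ (insert v P) := by
  obtain ⟨w, hw, hw1, rfl⟩ := hp
  have hne : ∀ u ∈ P, u ≠ v := fun u hu h => hv (h ▸ hu)
  refine ⟨fun u => if u = v then t else (1 - t) * w u, ?_, ?_, ?_⟩
  · intro u hu
    rcases Finset.mem_insert.1 hu with rfl | hu
    · simpa using ht0
    · simpa [hne u hu] using mul_pos (sub_pos.2 ht1) (hw u hu)
  · rw [Finset.sum_insert hv, Finset.sum_congr rfl (fun u hu => if_neg (hne u hu)),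
      ← Finset.mul_sum, hw1]
    simp
  · have h : ∀ u ∈ P, (if u = v then t else (1 - t) * w u) • φ u = (1 - t) • w u • φ u :=
      fun u hu => by rw [if_neg (hne u hu), mul_smul]
    rw [Finset.sum_insert hv, Finset.sum_congr rfl h, ← Finset.smul_sum,
      AffineMap.lineMap_apply_module, add_comm]
    simp

theorem mem_closure_openSimplex_insert [DecidableEq X] {P : Finset X} (hP : P.Nonempty) {v : X}
    (hv : v ∉ P) : φ v ∈ closure (openSimplex φ (insert v P)) := by
  obtain ⟨p, hp⟩ := openSimplex_nonempty (φ := φ) hP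
  have hc : Continuous fun t : ℝ => AffineMap.lineMap p (φ v) t := AffineMap.lineMap_continuous
  have ht : Filter.Tendsto (fun t : ℝ => AffineMap.lineMap p (φ v) t) (𝓝[<] 1) (𝓝 (φ v)) := by
    have := hc.tendsto 1
    rw [AffineMap.lineMap_apply_one] at this
    exact this.mono_left nhdsWithin_le_nhds
  refine mem_closure_of_tendsto ht ?_
  filter_upwards [Ioo_mem_nhdsLT (zero_lt_one' ℝ)] with t ht
  exact lineMap_mem_openSimplex_insert hv hp ht.1 ht.2

theorem closure_openSimplex_subset (s : Finset X) :
    closure (openSimplex φ s) ⊆ convexHull ℝ (φ '' s) :=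
  closure_minimal (openSimplex_subset_convexHull s)
    ((s.finite_toSet.image φ).isCompact_convexHull ℝ).isClosed

/-- An affine subspace which contains the open simplex contains its vertices. -/
theorem mem_of_openSimplex_subset [DecidableEq X] {s : Finset X} {H : AffineSubspace ℝ E}
    (h : openSimplex φ s ⊆ H) {v : X} (hv : v ∈ s) : φ v ∈ H := by
  rcases (s.erase v).eq_empty_or_nonempty with he | hne
  · refine h ⟨fun _ => 1, fun _ _ => one_pos, ?_, ?_⟩ <;>
      rw [← Finset.insert_erase hv, he] <;> simp
  · have h1 := mem_closure_openSimplex_insert (φ := φ) hne (Finset.notMem_erase v s)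
    rw [Finset.insert_erase hv] at h1
    exact closure_minimal h H.closed_of_finiteDimensional h1

end Simplices

/-! ### Charts of Coxeter complexes and their transport -/

section Charts

variable {X : Type*} {n : ℕ} {K : PreAbstractSimplicialComplex X}
  {W : Subgroup (EuclideanSpace ℝ (Fin n) ≃ᵃⁱ[ℝ] EuclideanSpace ℝ (Fin n))}
  {φ : X → EuclideanSpace ℝ (Fin n)}

local notation "E" => EuclideanSpace ℝ (Fin n)

theorem face_nonempty {s : Finset X} (hs : s ∈ K) : s.Nonempty := (K.isRelLowerSet_faces hs).1

theorem face_of_subset {s t : Finset X} (hs : s ∈ K) (hts : t ⊆ s) (ht : t.Nonempty) : t ∈ K :=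
  (K.isRelLowerSet_faces hs).2 hts ht

theorem IsChart.card_le (hφ : IsChart K W φ) {s : Finset X} (hs : s ∈ K) : s.card ≤ n + 1 := by
  have := (hφ.affineIndependent s hs).card_le_finrank_succ
  rw [Fintype.card_coe] at this
  refine this.trans (Nat.succ_le_succ ?_)
  have h := Submodule.finrank_le (vectorSpan ℝ (Set.range fun v : s => φ v))
  rwa [finrank_euclideanSpace_fin] at h

theorem IsChart.openSimplex_eq_cellOf (hφ : IsChart K W φ) {s : Finset X} (hs : s ∈ K) {x : E}
    (hx : x ∈ openSimplex φ s) : openSimplex φ s = cellOf W x :=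
  (hφ.isCell s hs).eq_cellOf hx

theorem IsChart.eq_of_openSimplex_eq (hφ : IsChart K W φ) {s t : Finset X} (hs : s ∈ K)
    (ht : t ∈ K) (h : openSimplex φ s = openSimplex φ t) : s = t :=
  (hφ.existsUnique _ (hφ.isCell t ht)).unique ⟨hs, h⟩ ⟨ht, rfl⟩

theorem IsChart.exists_mem_openSimplex (hφ : IsChart K W φ) (x : E) :
    ∃ s ∈ K, x ∈ openSimplex φ s := by
  obtain ⟨s, ⟨hs, h⟩, -⟩ := hφ.existsUnique (cellOf W x) ⟨x, rfl⟩
  exact ⟨s, hs, h ▸ mem_cellOf_self x⟩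

/-- A Euclidean Coxeter complex of dimension `n` has a simplex with `n + 1` vertices. -/
theorem IsChart.exists_card_eq (hφ : IsChart K W φ) (hW : IsAffineReflectionGroup W) :
    ∃ C ∈ K, C.card = n + 1 := by
  classical
  obtain ⟨x, hx⟩ := exists_notMem_mirrors hW
  obtain ⟨C, hC, hxC⟩ := hφ.exists_mem_openSimplex x
  refine ⟨C, hC, ?_⟩
  obtain ⟨ε, hε, hball⟩ := exists_ball_mem_cellOf hW x
  -- No mirror passes through `x`, so its cell contains a ball and the vertices of `C` span the
  -- space.
  have hsub : Metric.ball x ε ⊆ openSimplex φ C := by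
    rw [hφ.openSimplex_eq_cellOf hC hxC]
    exact fun y hy => hball x (Metric.mem_ball_self hε) y hy
      (fun H hH hxH => absurd hxH (hx H hH))
  have htop : affineSpan ℝ (Set.range fun v : C => φ v) = ⊤ := by
    have h1 : affineSpan ℝ (Metric.ball x ε) = ⊤ :=
      Metric.isOpen_ball.affineSpan_eq_top ⟨x, Metric.mem_ball_self hε⟩
    rw [eq_top_iff, ← h1]
    refine (affineSpan_mono ℝ (hsub.trans (openSimplex_subset_convexHull C))).trans ?_
    rw [affineSpan_convexHull]
    refine affineSpan_mono ℝ ?_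
    rintro _ ⟨v, hv, rfl⟩
    exact ⟨⟨v, hv⟩, rfl⟩
  have := (hφ.affineIndependent C hC).affineSpan_eq_top_iff_card_eq_finrank_add_one.1 htop
  rwa [Fintype.card_coe, finrank_euclideanSpace_fin] at this

/-- A chart of one complex can be transported along an isomorphism of the posets of faces. -/
theorem IsChart.transfer {L : PreAbstractSimplicialComplex X} (hφ : IsChart K W φ)
    (e : K.faces ≃o L.faces) {s : Finset X} (hs : s ∈ K)
    (he : ∀ u : K.faces, (u : Finset X) ⊆ s → (e u : Finset X) = u) :
    ∃ ψ : X → E, IsChart L W ψ ∧ ∀ v ∈ s, ψ v = φ v := by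
  classical
  -- the vertex of `K` which corresponds to a vertex of `L`
  have hvert : ∀ {K L : PreAbstractSimplicialComplex X} (e : K.faces ≃o L.faces) (v : X)
      (hv : {v} ∈ K), ∃ w, (e ⟨{v}, hv⟩ : Finset X) = {w} := by
    intro K L e v hv
    obtain ⟨w, hw⟩ := face_nonempty (e ⟨{v}, hv⟩).2
    have hwL : {w} ∈ L := face_of_subset (e ⟨{v}, hv⟩).2 (by simpa using hw) (by simp)
    have hle : (⟨{w}, hwL⟩ : L.faces) ≤ e ⟨{v}, hv⟩ := by
      show ({w} : Finset X) ⊆ _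
      simpa using hw
    -- Singletons are the minimal faces, and an order isomorphism preserves minimality.
    have h1 : ((e.symm ⟨{w}, hwL⟩ : K.faces) : Finset X) ⊆ {v} := by
      have := e.symm.monotone hle
      rw [e.symm_apply_apply] at this
      exact this
    have h2 : ((e.symm ⟨{w}, hwL⟩ : K.faces) : Finset X) = {v} :=
      (Finset.subset_singleton_iff.1 h1).resolve_left
        (face_nonempty (e.symm ⟨{w}, hwL⟩).2).ne_empty
    have h3 : e.symm ⟨{w}, hwL⟩ = ⟨{v}, hv⟩ := Subtype.ext h2
    refine ⟨w, ?_⟩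
    rw [← h3, e.apply_symm_apply]
  -- This yields the vertex map `β` induced by `e.symm`. Off the vertices of `L` its value plays no
  -- role.
  have hex : ∀ w, ∃ v, ∀ hw : {w} ∈ L, (e.symm ⟨{w}, hw⟩ : Finset X) = {v} := by
    intro w
    by_cases hw : {w} ∈ L
    · obtain ⟨v, hv⟩ := hvert e.symm w hw
      exact ⟨v, fun _ => hv⟩
    · exact ⟨w, fun h => absurd h hw⟩
  choose β hβ using hex
  have hsingle : ∀ {K : PreAbstractSimplicialComplex X} {t : Finset X}, t ∈ K → ∀ v ∈ t, {v} ∈ K :=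
    fun ht v hv => face_of_subset ht (by simpa using hv) (by simp)
  have hβinj : ∀ {v w}, {v} ∈ L → {w} ∈ L → β v = β w → v = w := by
    intro v w hv hw h
    have h1 : e.symm ⟨{v}, hv⟩ = e.symm ⟨{w}, hw⟩ := Subtype.ext (by rw [hβ v hv, hβ w hw, h])
    exact Finset.singleton_injective (congrArg Subtype.val (e.symm.injective h1))
  have himage : ∀ t (ht : t ∈ L), (e.symm ⟨t, ht⟩ : Finset X) = t.image β := by
    intro t ht
    ext v
    rw [Finset.mem_image]
    constructor
    · intro hv
      have hvK := hsingle (e.symm ⟨t, ht⟩).2 v hv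
      obtain ⟨w, hw⟩ := hvert e v hvK
      have hle : e ⟨{v}, hvK⟩ ≤ ⟨t, ht⟩ := by
        rw [← e.le_symm_apply]
        show ({v} : Finset X) ⊆ _
        simpa using hv
      have hwt : w ∈ t := by
        have : ({w} : Finset X) ⊆ t := hw ▸ hle
        simpa using this
      have hwL := hsingle ht w hwt
      have h1 : e ⟨{v}, hvK⟩ = ⟨{w}, hwL⟩ := Subtype.ext hw
      refine ⟨w, hwt, ?_⟩
      have h2 := hβ w hwL
      rw [← h1, e.symm_apply_apply] at h2
      exact (Finset.singleton_injective h2).symm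
    · rintro ⟨w, hw, rfl⟩
      have hwL := hsingle ht w hw
      have hle : (⟨{w}, hwL⟩ : L.faces) ≤ ⟨t, ht⟩ := by
        show ({w} : Finset X) ⊆ t
        simpa using hw
      have h1 : ((e.symm ⟨{w}, hwL⟩ : K.faces) : Finset X) ⊆ (e.symm ⟨t, ht⟩ : K.faces) :=
        e.symm.monotone hle
      rw [hβ w hwL] at h1
      simpa using h1
  have hinjOn : ∀ t ∈ L, Set.InjOn β (t : Set X) := fun t ht v hv w hw h =>
    hβinj (hsingle ht v hv) (hsingle ht w hw) h
  -- Since `β` is injective on faces, weights can be carried over in both directions. The chart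
  -- axioms about cells for `φ ∘ β` follow from this identity.
  have hopen : ∀ t (ht : t ∈ L),
      openSimplex (φ ∘ β) t = openSimplex φ (e.symm ⟨t, ht⟩ : Finset X) := by
    intro t ht
    have : Nonempty X := (face_nonempty ht).to_type
    rw [himage t ht]
    ext y
    constructor
    · rintro ⟨w, hw, hw1, rfl⟩
      have hext : ∀ v ∈ t, w (Function.invFunOn β (t : Set X) (β v)) = w v := fun v hv => by
        rw [(hinjOn t ht).leftInvOn_invFunOn hv]
      refine ⟨w ∘ Function.invFunOn β (t : Set X), ?_, ?_, ?_⟩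
      · intro u hu
        obtain ⟨v, hv, rfl⟩ := Finset.mem_image.1 hu
        rw [Function.comp_apply, hext v hv]
        exact hw v hv
      · rw [Finset.sum_image (hinjOn t ht), ← hw1]
        exact Finset.sum_congr rfl hext
      · rw [Finset.sum_image (hinjOn t ht)]
        exact Finset.sum_congr rfl fun v hv => by
          rw [Function.comp_apply, Function.comp_apply, hext v hv]
    · rintro ⟨w, hw, hw1, rfl⟩
      rw [Finset.sum_image (hinjOn t ht)] at hw1 ⊢
      exact ⟨w ∘ β, fun v hv => hw _ (Finset.mem_image_of_mem β hv), hw1, rfl⟩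
  refine ⟨φ ∘ β, ⟨fun t ht => ?_, fun t ht => ?_, fun A hA => ?_⟩, fun v hv => ?_⟩
  · have h1 := hφ.affineIndependent _ (e.symm ⟨t, ht⟩).2
    let f : t ↪ ((e.symm ⟨t, ht⟩ : K.faces) : Finset X) :=
      ⟨fun v => ⟨β v, by rw [himage t ht]; exact Finset.mem_image_of_mem β v.2⟩, fun v w h =>
        Subtype.ext (hinjOn t ht v.2 w.2 (congrArg Subtype.val h))⟩
    exact h1.comp_embedding f
  · rw [hopen t ht]
    exact hφ.isCell _ (e.symm ⟨t, ht⟩).2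
  · obtain ⟨t, ⟨ht, htA⟩, huniq⟩ := hφ.existsUnique A hA
    refine ⟨e ⟨t, ht⟩, ⟨(e ⟨t, ht⟩).2, ?_⟩, ?_⟩
    · rw [hopen _ (e ⟨t, ht⟩).2, Subtype.coe_eta, e.symm_apply_apply]
      exact htA
    · rintro u ⟨hu, huA⟩
      rw [hopen u hu] at huA
      have h1 : (e.symm ⟨u, hu⟩ : Finset X) = t := huniq _ ⟨(e.symm ⟨u, hu⟩).2, huA⟩
      have h2 : e.symm ⟨u, hu⟩ = ⟨t, ht⟩ := Subtype.ext h1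
      rw [← h2, e.apply_symm_apply]
  · have hvK := hsingle hs v hv
    have h1 : (e ⟨{v}, hvK⟩ : Finset X) = {v} := he ⟨{v}, hvK⟩ (by simpa using hv)
    have hvL : {v} ∈ L := h1 ▸ (e ⟨{v}, hvK⟩).2
    have h2 : e ⟨{v}, hvK⟩ = ⟨{v}, hvL⟩ := Subtype.ext h1
    have h3 := hβ v hvL
    rw [← h2, e.symm_apply_apply] at h3
    rw [Function.comp_apply, ← Finset.singleton_injective h3]

end Charts

/-! ### Panels, their walls, and adjacent chambers -/

section Panels

variable {X : Type*} {n : ℕ} {K : PreAbstractSimplicialComplex X}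
  {W : Subgroup (EuclideanSpace ℝ (Fin n) ≃ᵃⁱ[ℝ] EuclideanSpace ℝ (Fin n))}
  {φ : X → EuclideanSpace ℝ (Fin n)}

local notation "E" => EuclideanSpace ℝ (Fin n)

/-- A simplex with `n` vertices spans a hyperplane. -/
theorem isHyperplane_affineSpan {P : Finset X} (hP : P.Nonempty) (hcard : P.card = n)
    (hind : AffineIndependent ℝ (fun v : P => φ v)) : IsHyperplane (affineSpan ℝ (φ '' P)) := by
  obtain ⟨v, hv⟩ := hP
  refine ⟨⟨φ v, subset_affineSpan ℝ _ ⟨v, hv, rfl⟩⟩, ?_⟩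
  have hpos : 0 < P.card := Finset.card_pos.2 ⟨v, hv⟩
  have hr : φ '' P = Set.range fun v : P => φ v := by
    ext y; simp
  rw [direction_affineSpan, hr, hind.finrank_vectorSpan (n := P.card - 1)
    (by rw [Fintype.card_coe]; omega)]
  omega

theorem notMem_affineSpan_of_insert [DecidableEq X] {P : Finset X} {v : X} (hv : v ∉ P)
    (hind : AffineIndependent ℝ (fun u : (insert v P : Finset X) => φ u)) :
    φ v ∉ affineSpan ℝ (φ '' P) := by
  intro h
  have himg : (fun u : (insert v P : Finset X) => φ u) '' {u | (u : X) ∈ P} = φ '' P := by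
    ext y
    constructor
    · rintro ⟨u, hu, rfl⟩
      exact ⟨u, hu, rfl⟩
    · rintro ⟨u, hu, rfl⟩
      exact ⟨⟨u, Finset.mem_insert_of_mem hu⟩, hu, rfl⟩
  rw [← himg] at h
  exact hv ((hind.mem_affineSpan_iff ⟨v, Finset.mem_insert_self v P⟩ _).1 h)

/-- The hyperplane spanned by a panel is the unique mirror through any point in the
interior of the panel. -/
theorem IsChart.mirror_of_panel [DecidableEq X] (hφ : IsChart K W φ)
    (hW : IsAffineReflectionGroup W) {P : Finset X} (hPK : P ∈ K) (hcard : P.card = n) {p : E}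
    (hp : p ∈ openSimplex φ P) :
    affineSpan ℝ (φ '' P) ∈ mirrors W ∧
      ∀ H ∈ mirrors W, p ∈ H → H = affineSpan ℝ (φ '' P) := by
  have hhyp := isHyperplane_affineSpan (face_nonempty hPK) hcard (hφ.affineIndependent P hPK)
  have hcell := hφ.openSimplex_eq_cellOf hPK hp
  -- A mirror through `p` contains the cell of `p`, hence the vertices of `P` and their span;
  -- dimensions agree.
  have huniq : ∀ H ∈ mirrors W, p ∈ H → H = affineSpan ℝ (φ '' P) := by
    intro H hH hpH
    refine (hhyp.eq_of_le hH.1 ?_).symm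
    rw [affineSpan_le]
    rintro _ ⟨u, hu, rfl⟩
    refine mem_of_openSimplex_subset (fun y hy => ?_) hu
    rw [hcell] at hy
    rcases hy H hH with h | h
    · exact h.2
    · exact absurd hpH h.left_notMem
  refine ⟨?_, huniq⟩
  by_contra hcon
  -- Without a mirror through `p`, the open simplex of `P` would contain a ball.
  have hno : ∀ H ∈ mirrors W, p ∉ H := fun H hH hpH => hcon (huniq H hH hpH ▸ hH)
  obtain ⟨ε, hε, hball⟩ := exists_ball_mem_cellOf hW p
  have hspan : affineSpan ℝ (φ '' P) = ⊤ := by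
    have h1 : affineSpan ℝ (Metric.ball p ε) = ⊤ :=
      Metric.isOpen_ball.affineSpan_eq_top ⟨p, Metric.mem_ball_self hε⟩
    rw [eq_top_iff, ← h1, ← affineSpan_convexHull (𝕜 := ℝ) (s := φ '' P)]
    refine affineSpan_mono ℝ (subset_trans ?_ (openSimplex_subset_convexHull P))
    rw [hcell]
    exact fun y hy => hball p (Metric.mem_ball_self hε) y hy
      (fun H hH hpH => absurd hpH (hno H hH))
  exact hhyp.ne_top hspan

/-- Two distinct chambers of a Coxeter complex with a common panel are exchanged by the reflection
in the hyperplane spanned by the panel. -/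
theorem IsChart.reflection_panel [DecidableEq X] (hφ : IsChart K W φ)
    (hW : IsAffineReflectionGroup W) {P : Finset X} {v₁ v₂ : X} (hP : P.Nonempty)
    (hcard : P.card = n) (hv₁ : v₁ ∉ P) (hv₂ : v₂ ∉ P) (hne : v₁ ≠ v₂) (h₁ : insert v₁ P ∈ K)
    (h₂ : insert v₂ P ∈ K) [Nonempty (affineSpan ℝ (φ '' P))] :
    EuclideanGeometry.reflection (affineSpan ℝ (φ '' P)) (φ v₁) = φ v₂ := by
  obtain ⟨p, hp⟩ := openSimplex_nonempty (φ := φ) hP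
  obtain ⟨hmir, huniq⟩ := hφ.mirror_of_panel hW
    (face_of_subset h₁ (Finset.subset_insert v₁ P) hP) hcard hp
  set H := affineSpan ℝ (φ '' P) with hH
  set r := EuclideanGeometry.reflection H with hr
  have hrW : r ∈ W := hmir.2.choose_spec
  have hpH : p ∈ H := by
    have := openSimplex_subset_convexHull P hp
    exact convexHull_subset_affineSpan _ this
  have hrp : r p = p := (EuclideanGeometry.reflection_eq_self_iff p).2 hpH
  obtain ⟨η, hmem, hside⟩ := hmir.1.exists_affineMap
  have hη₁ : η (φ v₁) ≠ 0 := fun h => notMem_affineSpan_of_insert hv₁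
    (hφ.affineIndependent _ h₁) ((hmem _).2 h)
  have hη₂ : η (φ v₂) ≠ 0 := fun h => notMem_affineSpan_of_insert hv₂
    (hφ.affineIndependent _ h₂) ((hmem _).2 h)
  have hηr : ∀ x, η (r x) = -η x := by
    intro x
    have h1 := EuclideanGeometry.reflection_apply' H x
    have h2 : η (EuclideanGeometry.orthogonalProjection H x) = 0 :=
      (hmem _).1 (EuclideanGeometry.orthogonalProjection_mem x)
    rw [hr, h1, AffineMap.map_vadd, AffineMap.linearMap_vsub, h2]
    simp
  obtain ⟨ε, hε, hball⟩ := exists_ball_mem_cellOf hW p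
  -- points of both chambers close to `p`
  have hclose : ∀ v, ∀ᶠ t : ℝ in 𝓝[>] 0, AffineMap.lineMap p (φ v) t ∈ Metric.ball p ε := by
    intro v
    have hc : Continuous fun t : ℝ => AffineMap.lineMap p (φ v) t := AffineMap.lineMap_continuous
    have := hc.tendsto 0
    rw [AffineMap.lineMap_apply_zero] at this
    exact (this.mono_left nhdsWithin_le_nhds) (Metric.ball_mem_nhds p hε)
  obtain ⟨t, ht₁, ht₂, ht0, ht1⟩ := ((hclose v₁).and ((hclose v₂).and
    (Ioo_mem_nhdsGT (zero_lt_one' ℝ)))).exists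
  have hx₁ := lineMap_mem_openSimplex_insert hv₁ hp ht0 ht1
  have hx₂ := lineMap_mem_openSimplex_insert hv₂ hp ht0 ht1
  have hηt : ∀ v, η (AffineMap.lineMap p (φ v) t) = t * η (φ v) := by
    intro v
    rw [AffineMap.apply_lineMap, AffineMap.lineMap_apply_ring', (hmem p).1 hpH]
    ring
  set x₁ := AffineMap.lineMap p (φ v₁) t with hx₁def
  set x₂ := AffineMap.lineMap p (φ v₂) t with hx₂def
  -- Near `p` the only mirror is `H`, so the sign of `η` decides the cell.
  have hloc : ∀ x ∈ Metric.ball p ε, ∀ y ∈ Metric.ball p ε, 0 < η x * η y → y ∈ cellOf W x := by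
    intro x hx y hy hxy
    refine hball x hx y hy fun H' hH' hpH' => Or.inr ?_
    rw [huniq H' hH' hpH', hside]
    exact hxy
  -- On the same side of `H` the two chambers would share a cell and coincide.
  have hopp : η (φ v₁) * η (φ v₂) < 0 := by
    by_contra hcon
    have hpos : 0 < η (φ v₁) * η (φ v₂) :=
      lt_of_le_of_ne (not_lt.1 hcon) (mul_ne_zero hη₁ hη₂).symm
    have h3 : x₂ ∈ cellOf W x₁ := by
      refine hloc _ ht₁ _ ht₂ ?_
      rw [hηt, hηt]
      have := mul_pos (mul_pos ht0 ht0) hpos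
      linarith
    have h4 : openSimplex φ (insert v₁ P) = openSimplex φ (insert v₂ P) := by
      rw [hφ.openSimplex_eq_cellOf h₁ hx₁, hφ.openSimplex_eq_cellOf h₂ hx₂, cellOf_eq_of_mem h3]
    have h5 := hφ.eq_of_openSimplex_eq h₁ h₂ h4
    have h6 : v₁ ∈ insert v₂ P := h5 ▸ Finset.mem_insert_self v₁ P
    exact (Finset.mem_insert.1 h6).elim hne hv₁
  have hrx : r x₁ ∈ cellOf W x₂ := by
    refine hloc _ ht₂ _ ?_ ?_
    · rw [Metric.mem_ball] at ht₁ ⊢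
      rw [← hrp, r.dist_map]
      rwa [hrp] at *
    · rw [hηr, hηt, hηt]
      have := mul_pos (mul_pos ht0 ht0) (neg_pos.2 hopp)
      linarith
  have hmaps₁ : ∀ x ∈ openSimplex φ (insert v₁ P), r x ∈ openSimplex φ (insert v₂ P) := by
    intro x hx
    rw [hφ.openSimplex_eq_cellOf h₁ hx₁] at hx
    rw [hφ.openSimplex_eq_cellOf h₂ hx₂, ← cellOf_eq_of_mem hrx]
    exact map_mem_cellOf hrW hx
  have hmaps₂ : ∀ x ∈ openSimplex φ (insert v₂ P), r x ∈ openSimplex φ (insert v₁ P) := by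
    intro x hx
    rw [hφ.openSimplex_eq_cellOf h₂ hx₂, ← cellOf_eq_of_mem hrx] at hx
    rw [hφ.openSimplex_eq_cellOf h₁ hx₁]
    have := map_mem_cellOf hrW hx
    rwa [hr, EuclideanGeometry.reflection_reflection] at this
  -- By continuity `r (φ v)` lies in the closed simplex, which is the join of `φ w` with the convex
  -- hull of the panel.
  have hvert : ∀ {v w : X}, v ∉ P →
      (∀ x ∈ openSimplex φ (insert v P), r x ∈ openSimplex φ (insert w P)) →
      ∃ (a : ℝ) (q : E), 0 ≤ a ∧ a ≤ 1 ∧ q ∈ H ∧ r (φ v) = AffineMap.lineMap q (φ w) a := by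
    intro v w hv hmaps
    have h1 : r (φ v) ∈ closure (openSimplex φ (insert w P)) :=
      map_mem_closure r.continuous (mem_closure_openSimplex_insert hP hv) hmaps
    have h2 := closure_openSimplex_subset _ h1
    rw [Finset.coe_insert, Set.image_insert_eq, convexHull_insert
      ((Finset.coe_nonempty.2 hP).image φ), convexJoin_singleton_left] at h2
    obtain ⟨q, hq, hseg⟩ := Set.mem_iUnion₂.1 h2
    rw [segment_symm, segment_eq_image_lineMap] at hseg
    obtain ⟨a, ha, h⟩ := hseg
    exact ⟨a, q, ha.1, ha.2, convexHull_subset_affineSpan _ hq, h.symm⟩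
  obtain ⟨a, q, ha0, ha1, hq, hra⟩ := hvert hv₁ hmaps₁
  obtain ⟨b, q', hb0, hb1, hq', hrb⟩ := hvert hv₂ hmaps₂
  have hηa := congrArg η hra
  have hηb := congrArg η hrb
  rw [hηr, AffineMap.apply_lineMap, AffineMap.lineMap_apply_ring', (hmem _).1 hq] at hηa
  rw [hηr, AffineMap.apply_lineMap, AffineMap.lineMap_apply_ring', (hmem _).1 hq'] at hηb
  -- Applying `η` gives `-η (φ v₁) = a * η (φ v₂)` and `-η (φ v₂) = b * η (φ v₁)`. As `a` and `b`
  -- lie in `[0, 1]`, both are `1`.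
  have hab : a * b = 1 := by
    have : η (φ v₁) * (a * b - 1) = 0 := by linear_combination hηa - a * hηb
    have := (mul_eq_zero.1 this).resolve_left hη₁
    linarith
  have ha : a = 1 := by nlinarith
  rw [hra, ha, AffineMap.lineMap_apply_one]

end Panels

/-! ### Affine functions and feet of perpendiculars -/

section AffineFunctions

variable {X : Type*} {n : ℕ} {φ : X → EuclideanSpace ℝ (Fin n)}

local notation "E" => EuclideanSpace ℝ (Fin n)

/-- A function which is affine on segments is an affine map. -/
theorem exists_affineMap_of_segments {F : E → ℝ}
    (hF : ∀ t ∈ Set.Icc (0 : ℝ) 1, ∀ x y, F (t • x + (1 - t) • y) = t * F x + (1 - t) * F y) :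
    ∃ A : E →ᵃ[ℝ] ℝ, ∀ x, A x = F x := by
  have hsmul01 : ∀ t ∈ Set.Icc (0 : ℝ) 1, ∀ x, F (t • x) - F 0 = t * (F x - F 0) := by
    intro t ht x
    have := hF t ht x 0
    rw [smul_zero, add_zero] at this
    rw [this]; ring
  have hsmul : ∀ t : ℝ, 0 ≤ t → ∀ x, F (t • x) - F 0 = t * (F x - F 0) := by
    intro t ht x
    rcases le_total t 1 with h1 | h1
    · exact hsmul01 t ⟨ht, h1⟩ x
    · have ht0 : t ≠ 0 := by linarith
      have := hsmul01 t⁻¹ ⟨inv_nonneg.2 ht, inv_le_one_of_one_le₀ h1⟩ (t • x)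
      rw [inv_smul_smul₀ ht0] at this
      rw [this, mul_inv_cancel_left₀ ht0]
  have hadd : ∀ x y, F (x + y) - F 0 = (F x - F 0) + (F y - F 0) := by
    intro x y
    have h1 := hF (1 / 2) ⟨by norm_num, by norm_num⟩ x y
    -- The sum `x + y` is twice the midpoint.
    have h2 := hsmul 2 (by norm_num) ((1 / 2 : ℝ) • x + (1 - 1 / 2 : ℝ) • y)
    have h3 : (2 : ℝ) • ((1 / 2 : ℝ) • x + (1 - 1 / 2 : ℝ) • y) = x + y := by
      rw [smul_add, smul_smul, smul_smul]; norm_num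
    rw [h3, h1] at h2
    rw [h2]; ring
  have hneg : ∀ x, F (-x) - F 0 = -(F x - F 0) := by
    intro x
    have := hadd x (-x)
    rw [add_neg_cancel] at this
    linarith
  let ℓ : E →ₗ[ℝ] ℝ :=
    { toFun := fun x => F x - F 0
      map_add' := hadd
      map_smul' := by
        intro t x
        simp only [RingHom.id_apply, smul_eq_mul]
        rcases le_total 0 t with ht | ht
        · exact hsmul t ht x
        · have := hsmul (-t) (by linarith) (-x)
          rw [smul_neg, neg_smul, neg_neg, hneg] at this
          rw [this]; ring }
  refine ⟨ℓ.toAffineMap + AffineMap.const ℝ E (F 0), fun x => ?_⟩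
  simp [ℓ]

theorem map_weighted_sum (A : E →ᵃ[ℝ] ℝ) {s : Finset X} {b : X → ℝ} (hb : ∑ v ∈ s, b v = 1) :
    A (∑ v ∈ s, b v • φ v) = ∑ v ∈ s, b v * A (φ v) := by
  have hA : ∀ x, A x = A.linear x + A 0 := fun x => congrFun A.decomp x
  have h : ∀ v ∈ s, b v * A (φ v) = A.linear (b v • φ v) + b v * A 0 := fun v _ => by
    rw [hA (φ v), mul_add, map_smul, smul_eq_mul]
  rw [hA, map_sum, Finset.sum_congr rfl h, Finset.sum_add_distrib, ← Finset.sum_mul, hb, one_mul]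

/-- The point `∑ b p • φ p` is the foot of the perpendicular from `φ v` to the affine span of the
points `φ p`, `p ∈ P`. -/
def IsFoot (φ : X → EuclideanSpace ℝ (Fin n)) (P : Finset X) (v : X) (b : X → ℝ) : Prop :=
  ∑ p ∈ P, b p = 1 ∧
    ∀ p ∈ P, ∀ q ∈ P, inner ℝ (φ v - ∑ u ∈ P, b u • φ u) (φ p - φ q) = 0

/-- This carries `b` from one apartment to another when the charts agree on the chamber. -/
theorem IsFoot.congr {ψ : X → E} {P : Finset X} {v : X} {b : X → ℝ} (h : IsFoot φ P v b)
    (hv : ψ v = φ v) (hP : ∀ p ∈ P, ψ p = φ p) : IsFoot ψ P v b := by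
  refine ⟨h.1, fun p hp q hq => ?_⟩
  rw [hv, hP p hp, hP q hq, Finset.sum_congr rfl (fun u hu => by rw [hP u hu])]
  exact h.2 p hp q hq

theorem weighted_sum_mem_affineSpan {P : Finset X} {b : X → ℝ} (hb : ∑ p ∈ P, b p = 1) :
    ∑ p ∈ P, b p • φ p ∈ affineSpan ℝ (φ '' P) := by
  have := affineCombination_mem_affineSpan_image (k := ℝ) (s := P) (w := b) hb (s' := (P : Set X))
    (fun i hi hi' => absurd hi hi') φ
  rwa [Finset.affineCombination_eq_linear_combination _ _ _ hb] at this

theorem exists_isFoot {P : Finset X} (hP : P.Nonempty) (v : X) : ∃ b, IsFoot φ P v b := by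
  classical
  obtain ⟨p₀, hp₀⟩ := hP
  have hmem : ∀ p ∈ P, φ p ∈ affineSpan ℝ (φ '' P) := fun p hp =>
    subset_affineSpan ℝ _ ⟨p, hp, rfl⟩
  have : Nonempty (affineSpan ℝ (φ '' P)) := ⟨⟨φ p₀, hmem p₀ hp₀⟩⟩
  obtain ⟨q, hq⟩ : ∃ q : E,
      q = ↑(EuclideanGeometry.orthogonalProjection (affineSpan ℝ (φ '' P)) (φ v)) := ⟨_, rfl⟩
  have hqmem : q ∈ affineSpan ℝ (φ '' P) := hq ▸ EuclideanGeometry.orthogonalProjection_mem _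
  have hr : φ '' P = Set.range fun v : P => φ v := by
    ext y; simp
  have hq2 := hqmem
  rw [hr] at hq2
  obtain ⟨w, hw1, hw⟩ := eq_affineCombination_of_mem_affineSpan_of_fintype hq2
  rw [Finset.affineCombination_eq_linear_combination _ _ _ hw1] at hw
  let b : X → ℝ := fun u => if h : u ∈ P then w ⟨u, h⟩ else 0
  have hbw : ∀ u : P, b u = w u := fun u => by simp [b]
  have hb1 : ∑ p ∈ P, b p = 1 := by
    rw [← hw1, ← Finset.sum_coe_sort P]
    exact Finset.sum_congr rfl fun u _ => hbw u
  have hbq : ∑ u ∈ P, b u • φ u = q := by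
    rw [hw, ← Finset.sum_coe_sort P]
    exact Finset.sum_congr rfl fun u _ => by rw [hbw u]
  refine ⟨b, hb1, fun p hp p' hp' => ?_⟩
  rw [hbq, hq]
  have h1 := EuclideanGeometry.vsub_orthogonalProjection_mem_direction_orthogonal
    (affineSpan ℝ (φ '' P)) (φ v)
  exact (Submodule.mem_orthogonal' _ _).1 h1 _
    (AffineSubspace.vsub_mem_direction (hmem p hp) (hmem p' hp'))

theorem IsFoot.reflection_eq {P : Finset X} {v : X} {b : X → ℝ} (h : IsFoot φ P v b)
    [Nonempty (affineSpan ℝ (φ '' P))] :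
    EuclideanGeometry.reflection (affineSpan ℝ (φ '' P)) (φ v) =
      -(φ v - ∑ p ∈ P, b p • φ p) + ∑ p ∈ P, b p • φ p := by
  have horth : φ v - ∑ p ∈ P, b p • φ p ∈ (affineSpan ℝ (φ '' P)).directionᗮ := by
    rw [Submodule.mem_orthogonal, direction_affineSpan, vectorSpan_def]
    intro u hu
    induction hu using Submodule.span_induction with
    | mem x hx =>
      obtain ⟨_, ⟨p, hp, rfl⟩, _, ⟨q, hq, rfl⟩, rfl⟩ := hx
      rw [real_inner_comm]
      exact h.2 p hp q hq
    | zero => exact inner_zero_left _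
    | add x y _ _ hx hy => rw [inner_add_left, hx, hy, add_zero]
    | smul c x _ hx => rw [inner_smul_left, hx, mul_zero]
  have := EuclideanGeometry.reflection_orthogonal_vadd (weighted_sum_mem_affineSpan h.1) horth
  rw [vadd_eq_add, vadd_eq_add, sub_add_cancel] at this
  exact this

/-- An affine function on `ℝⁿ` which takes at each vertex of a simplex the same value as at the foot
of the perpendicular to the opposite facet is constant. -/
theorem linear_eq_zero_of_isFoot [DecidableEq X] {C : Finset X} (hcard : C.card = n + 1)
    (hind : AffineIndependent ℝ (fun v : C => φ v)) (A : E →ᵃ[ℝ] ℝ)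
    (hA : ∀ v ∈ C, ∃ b, IsFoot φ (C.erase v) v b ∧ A (φ v) = ∑ p ∈ C.erase v, b p * A (φ p)) :
    A.linear = 0 := by
  have htop : affineSpan ℝ (Set.range fun v : C => φ v) = ⊤ := by
    rw [hind.affineSpan_eq_top_iff_card_eq_finrank_add_one, Fintype.card_coe,
      finrank_euclideanSpace_fin, hcard]
  let B : AffineBasis C ℝ E := ⟨fun v : C => φ v, hind, htop⟩
  have hB : ∀ v : C, B v = φ v := fun _ => rfl
  obtain ⟨g, hg⟩ : ∃ g : E, ∀ x, A.linear x = inner ℝ g x :=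
    ⟨(InnerProductSpace.toDual ℝ E).symm (LinearMap.toContinuousLinearMap A.linear), fun x => by
      rw [InnerProductSpace.toDual_symm_apply]; rfl⟩
  have hexp : ∀ x : E, ∑ u : C, (B.coord u).linear x = 0 ∧
      ∑ u : C, (B.coord u).linear x • φ u = x := by
    intro x
    have hlin : ∀ u : C, (B.coord u).linear x = B.coord u x - B.coord u 0 := by
      intro u
      have := (B.coord u).linearMap_vsub x 0
      simpa using this
    constructor
    · rw [Finset.sum_congr rfl (fun u _ => hlin u), Finset.sum_sub_distrib,
        B.sum_coord_apply_eq_one, B.sum_coord_apply_eq_one, sub_self]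
    · have h1 := B.linear_combination_coord_eq_self x
      have h2 := B.linear_combination_coord_eq_self 0
      rw [Finset.sum_congr rfl (fun u _ => by rw [hlin u, sub_smul]), Finset.sum_sub_distrib]
      simp only [hB] at h1 h2
      rw [h1, h2, sub_zero]
  have hcoord : ∀ v : C, (B.coord v).linear g = 0 := by
    intro v
    obtain ⟨b, hb, hAv⟩ := hA v v.2
    set q := ∑ p ∈ C.erase (v : X), b p • φ p with hq
    have hgq : inner ℝ g (φ v - q) = 0 := by
      rw [← hg, ← vsub_eq_sub, A.linearMap_vsub, hq, map_weighted_sum A hb.1, ← hAv, vsub_self]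
    have hvq : (B.coord v).linear (φ v - q) = 1 := by
      rw [← vsub_eq_sub, (B.coord v).linearMap_vsub, hq, map_weighted_sum _ hb.1,
        Finset.sum_eq_zero, vsub_eq_sub, sub_zero, ← hB v, B.coord_apply_eq]
      intro p hp
      have hpC : p ∈ C := Finset.mem_of_mem_erase hp
      have hne : v ≠ ⟨p, hpC⟩ := fun h => (Finset.ne_of_mem_erase hp) (congrArg Subtype.val h).symm
      have := B.coord_apply_ne hne
      rw [hB] at this
      rw [this, mul_zero]
    -- The kernel of this linear part is the direction of the facet opposite `v`, to which `φ v - q`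
    -- is normal.
    have hzero : ∀ h : E, (B.coord v).linear h = 0 → inner ℝ (φ v - q) h = 0 := by
      intro h hh
      obtain ⟨h1, h2⟩ := hexp h
      by_cases hemp : ∃ p₀, p₀ ∈ C.erase (v : X)
      · obtain ⟨p₀, hp₀⟩ := hemp
        have key : ∀ u : C, inner ℝ (φ v - q) ((B.coord u).linear h • φ u) =
            (B.coord u).linear h * inner ℝ (φ v - q) (φ p₀) := by
          intro u
          rw [real_inner_smul_right]
          by_cases huv : u = v
          · rw [huv, hh, zero_mul, zero_mul]
          · have hu : (u : X) ∈ C.erase (v : X) :=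
              Finset.mem_erase.2 ⟨fun h => huv (Subtype.ext h), u.2⟩
            have := hb.2 u hu p₀ hp₀
            rw [inner_sub_right, sub_eq_zero] at this
            rw [this]
        rw [← h2, inner_sum, Finset.sum_congr rfl (fun u _ => key u), ← Finset.sum_mul, h1,
          zero_mul]
      · have : C.erase (v : X) = ∅ := Finset.eq_empty_of_forall_notMem (not_exists.1 hemp)
        have := hb.1
        simp_all
    set c := (B.coord v).linear g with hc
    -- Subtracting `c • (φ v - q)` moves `g` into the facet direction. As `g` is orthogonal to `φ v
    -- - q`, this leaves `c * ‖φ v - q‖² = 0`.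
    have h3 := hzero (g - c • (φ v - q)) (by rw [map_sub, map_smul, hvq, ← hc]; simp)
    rw [inner_sub_right, real_inner_comm, hgq, real_inner_smul_right, zero_sub, neg_eq_zero] at h3
    refine (mul_eq_zero.1 h3).resolve_right fun h4 => ?_
    rw [inner_self_eq_zero.1 h4, map_zero] at hvq
    exact zero_ne_one hvq
  have hg0 : g = 0 := by
    rw [← (hexp g).2]
    exact Finset.sum_eq_zero fun u _ => by rw [hcoord u, zero_smul]
  ext1 x
  rw [hg, hg0, inner_zero_left, LinearMap.zero_apply]

end AffineFunctions

/-! ### Affine functionals in a chart -/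

section Functionals

variable {X : Type*} {Ω : PreAbstractSimplicialComplex X}
  {𝒜 : Set (PreAbstractSimplicialComplex X)}

/-- In a chart of an apartment, an affine functional is an affine function. -/
theorem IsAffineFunctional.exists_affineMap {f : Realisation Ω → ℝ}
    (hf : IsAffineFunctional Ω 𝒜 f) {K : PreAbstractSimplicialComplex X} (hK : K ∈ 𝒜)
    (hKΩ : K ≤ Ω) {n : ℕ}
    {W : Subgroup (EuclideanSpace ℝ (Fin n) ≃ᵃⁱ[ℝ] EuclideanSpace ℝ (Fin n))}
    {φ : X → EuclideanSpace ℝ (Fin n)} (hW : IsEuclideanReflectionGroup W)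
    (hφ : IsChart K W φ) :
    ∃ A : EuclideanSpace ℝ (Fin n) →ᵃ[ℝ] ℝ,
      ∀ x : Realisation Ω, x.1.support ∈ K → f x = A (chartMap φ x) := by
  classical
  have hsurj : ∀ y, ∃ x : Realisation Ω, x.1.support ∈ K ∧ chartMap φ x = y := by
    intro y
    obtain ⟨s, hs, w, hw, hw1, rfl⟩ := hφ.exists_mem_openSimplex y
    let p : X →₀ ℝ := Finsupp.onFinset s (fun v => if v ∈ s then w v else 0)
      (fun v hv => by by_contra h; simp [h] at hv)
    have hp : ∀ v ∈ s, p v = w v := fun v hv => by simp [p, hv]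
    have hsupp : p.support = s := by
      ext v
      rw [Finsupp.mem_support_iff]
      constructor
      · intro hv
        by_contra h
        simp [p, h] at hv
      · intro hv
        rw [hp v hv]
        exact (hw v hv).ne'
    refine ⟨⟨p, ?_, fun v => ?_, ?_⟩, ?_, ?_⟩
    · rw [hsupp]
      exact hKΩ hs
    · by_cases hv : v ∈ s
      · rw [hp v hv]
        exact (hw v hv).le
      · simp [p, hv]
    · rw [Finsupp.sum, hsupp, Finset.sum_congr rfl hp, hw1]
    · show p.support ∈ K
      rwa [hsupp]
    · show p.sum (fun v a => a • φ v) = _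
      rw [Finsupp.sum, hsupp]
      exact Finset.sum_congr rfl fun v hv => by rw [hp v hv]
  choose x hxK hx using hsurj
  have hcomb : ∀ t ∈ Set.Icc (0 : ℝ) 1, ∀ a b c : Realisation Ω, a.1.support ∈ K →
      b.1.support ∈ K → c.1.support ∈ K →
      chartMap φ c = t • chartMap φ a + (1 - t) • chartMap φ b →
      f c = t * f a + (1 - t) * f b := fun t ht a b c ha hb hc h =>
    hf t ht a b c ⟨K, hK, ha, hb, hc, n, W, φ, hW, hφ, h⟩
  obtain ⟨A, hA⟩ := exists_affineMap_of_segments (F := fun y => f (x y)) fun t ht y z =>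
    hcomb t ht _ _ _ (hxK y) (hxK z) (hxK _) (by rw [hx, hx, hx])
  refine ⟨A, fun y hy => ?_⟩
  rw [hA]
  -- The chosen preimage of `chartMap φ y` need not be `y` by construction; the affine relation at
  -- `t = 1` gives equal values.
  have := hcomb 1 ⟨zero_le_one, le_rfl⟩ (x (chartMap φ y)) (x (chartMap φ y)) y (hxK _) (hxK _) hy
    (by rw [hx]; simp)
  rw [this]
  ring

/-- The vertex `v` as a point of the realisation. -/
noncomputable def vertexPoint {v : X} (hv : {v} ∈ Ω) : Realisation Ω :=
  ⟨Finsupp.single v 1, by rwa [Finsupp.support_single v one_ne_zero],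
    fun u => by
      classical
      rw [Finsupp.single_apply]
      split_ifs <;> norm_num, by simp⟩

theorem support_vertexPoint {v : X} (hv : {v} ∈ Ω) : (vertexPoint hv).1.support = {v} :=
  Finsupp.support_single v one_ne_zero

theorem chartMap_vertexPoint {n : ℕ} (φ : X → EuclideanSpace ℝ (Fin n)) {v : X} (hv : {v} ∈ Ω) :
    chartMap φ (vertexPoint hv) = φ v := by
  simp [chartMap, vertexPoint]

end Functionals

/-! ### Thick buildings: comparing chambers at a panel -/

section Buildings

variable {X : Type*} {Ω : PreAbstractSimplicialComplex X}
  {𝒜 : Set (PreAbstractSimplicialComplex X)}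

/-- An infinite reflection group acts on a space of positive dimension. -/
theorem IsEuclideanReflectionGroup.dim_pos {n : ℕ}
    {W : Subgroup (EuclideanSpace ℝ (Fin n) ≃ᵃⁱ[ℝ] EuclideanSpace ℝ (Fin n))}
    (hW : IsEuclideanReflectionGroup W) : 0 < n := by
  rcases Nat.eq_zero_or_pos n with rfl | h
  · have : Subsingleton W := ⟨fun g h => Subtype.ext (AffineIsometryEquiv.ext fun x =>
      Subsingleton.elim _ _)⟩
    exact absurd (inferInstance : Finite W) (not_finite_iff_infinite.2 hW.infinite)
  · exact h

/-- Apartments with a common face have charts which agree on this face. -/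
theorem IsEuclideanBuilding.exists_chart (hΩ : IsEuclideanBuilding Ω 𝒜)
    {K L : PreAbstractSimplicialComplex X} (hK : K ∈ 𝒜) (hL : L ∈ 𝒜) {s : Finset X} (hsK : s ∈ K)
    (hsL : s ∈ L) {n : ℕ}
    {W : Subgroup (EuclideanSpace ℝ (Fin n) ≃ᵃⁱ[ℝ] EuclideanSpace ℝ (Fin n))}
    {φ : X → EuclideanSpace ℝ (Fin n)} (hφ : IsChart K W φ) :
    ∃ ψ : X → EuclideanSpace ℝ (Fin n), IsChart L W ψ ∧ ∀ v ∈ s, ψ v = φ v := by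
  obtain ⟨e, he⟩ := hΩ.exists_iso K hK L hL s s hsK hsK hsL hsL
  exact hφ.transfer e hsK fun u hu => he u (Or.inl hu)

/-- A face of an apartment with the maximal possible number of vertices is a chamber. -/
theorem IsEuclideanBuilding.isChamber (hΩ : IsEuclideanBuilding Ω 𝒜)
    {K : PreAbstractSimplicialComplex X} (hK : K ∈ 𝒜) {n : ℕ}
    {W : Subgroup (EuclideanSpace ℝ (Fin n) ≃ᵃⁱ[ℝ] EuclideanSpace ℝ (Fin n))}
    {φ : X → EuclideanSpace ℝ (Fin n)} (hφ : IsChart K W φ) {C : Finset X} (hC : C ∈ K)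
    (hcard : C.card = n + 1) : IsChamber Ω C := by
  refine ⟨hΩ.subcomplex K hK hC, fun s hs hCs => ?_⟩
  obtain ⟨L, hL, hsL⟩ := hΩ.cover s hs
  -- The transported chart has the same dimension `n`, so `s` has at most `n + 1` vertices.
  obtain ⟨ψ, hψ, -⟩ := hΩ.exists_chart hK hL hC
    (face_of_subset hsL hCs (face_nonempty hC)) hφ
  exact (Finset.eq_of_subset_of_card_le hCs ((hψ.card_le hsL).trans hcard.ge)).symm

/-- The values of an affine functional at two adjacent chambers are symmetric with respect to their
common panel. -/
theorem IsEuclideanBuilding.add_eq_of_adjacent [DecidableEq X] (hΩ : IsEuclideanBuilding Ω 𝒜)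
    {f : Realisation Ω → ℝ} (hf : IsAffineFunctional Ω 𝒜 f) {a : X → ℝ}
    (ha : ∀ v (hv : {v} ∈ Ω), f (vertexPoint hv) = a v)
    {K : PreAbstractSimplicialComplex X} (hK : K ∈ 𝒜) {n : ℕ}
    {W : Subgroup (EuclideanSpace ℝ (Fin n) ≃ᵃⁱ[ℝ] EuclideanSpace ℝ (Fin n))}
    {φ : X → EuclideanSpace ℝ (Fin n)} (hW : IsEuclideanReflectionGroup W) (hφ : IsChart K W φ)
    {P : Finset X} {v₁ v₂ : X} (hP : P.Nonempty)
    (hcard : P.card = n) (hv₁ : v₁ ∉ P) (hv₂ : v₂ ∉ P) (hne : v₁ ≠ v₂) (h₁ : insert v₁ P ∈ K)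
    (h₂ : insert v₂ P ∈ K) {b : X → ℝ} (hb : IsFoot φ P v₁ b) :
    a v₁ + a v₂ = 2 * ∑ p ∈ P, b p * a p ∧ IsFoot φ P v₂ b := by
  have : Nonempty (affineSpan ℝ (φ '' P)) :=
    hP.elim fun p hp => ⟨⟨φ p, subset_affineSpan ℝ _ ⟨p, hp, rfl⟩⟩⟩
  have hrefl := hφ.reflection_panel hW.reflectionGroup hP hcard hv₁ hv₂ hne h₁ h₂
  rw [hb.reflection_eq] at hrefl
  obtain ⟨A, hA⟩ := hf.exists_affineMap hK (hΩ.subcomplex K hK) hW hφ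
  have hAa : ∀ {s : Finset X}, s ∈ K → ∀ v ∈ s, A (φ v) = a v := by
    intro s hs v hv
    have hvK : {v} ∈ K := face_of_subset hs (by simpa using hv) (by simp)
    have hvΩ := hΩ.subcomplex K hK hvK
    rw [← ha v hvΩ, hA _ (by rwa [support_vertexPoint]), chartMap_vertexPoint]
  have hsum : ∑ p ∈ P, b p * a p = A (∑ p ∈ P, b p • φ p) := by
    rw [map_weighted_sum A hb.1]
    exact Finset.sum_congr rfl fun p hp => by rw [hAa h₁ p (Finset.mem_insert_of_mem hp)]
  set q := ∑ p ∈ P, b p • φ p with hq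
  refine ⟨?_, hb.1, fun p hp p' hp' => ?_⟩
  · rw [hsum, ← hAa h₁ v₁ (Finset.mem_insert_self _ _), ← hAa h₂ v₂ (Finset.mem_insert_self _ _),
      ← hrefl, ← vadd_eq_add (-(φ v₁ - q)), A.map_vadd, ← vsub_eq_sub, map_neg, A.linearMap_vsub]
    simp only [vsub_eq_sub, vadd_eq_add]
    ring
  -- The reflection turns `φ v₁ - q` into its negative, so `q` is also the foot from `φ v₂`.
  · rw [← hrefl, ← hq, add_sub_cancel_right, inner_neg_left, hb.2 p hp p' hp', neg_zero]

/-- In a thick building, the value of an affine functional at a vertex of a chamber is its value at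
the foot of the perpendicular to the opposite panel. -/
theorem IsEuclideanBuilding.eq_sum_of_isFoot [DecidableEq X] (hΩ : IsEuclideanBuilding Ω 𝒜)
    (hthick : IsThick Ω) {f : Realisation Ω → ℝ} (hf : IsAffineFunctional Ω 𝒜 f) {a : X → ℝ}
    (ha : ∀ v (hv : {v} ∈ Ω), f (vertexPoint hv) = a v)
    {K : PreAbstractSimplicialComplex X} (hK : K ∈ 𝒜) {n : ℕ}
    {W : Subgroup (EuclideanSpace ℝ (Fin n) ≃ᵃⁱ[ℝ] EuclideanSpace ℝ (Fin n))}
    {φ : X → EuclideanSpace ℝ (Fin n)} (hW : IsEuclideanReflectionGroup W) (hφ : IsChart K W φ)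
    {P : Finset X} {v : X} (hP : P.Nonempty) (hcard : P.card = n) (hv : v ∉ P)
    (hC : insert v P ∈ K) {b : X → ℝ} (hb : IsFoot φ P v b) :
    a v = ∑ p ∈ P, b p * a p := by
  have hCcard : (insert v P).card = n + 1 := by rw [Finset.card_insert_of_notMem hv, hcard]
  have hCΩ := hΩ.subcomplex K hK hC
  have hch := hΩ.isChamber hK hφ hC hCcard
  have hPC : P ⊆ insert v P := Finset.subset_insert v P
  have hthree := hthick P (face_of_subset hCΩ hPC hP) ⟨_, hch, hPC, by rw [hCcard, hcard]⟩
  obtain ⟨C₂, C₃, hC₂, hC₃, h₂₃⟩ : ∃ C₂ C₃,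
      C₂ ∈ {C | IsChamber Ω C ∧ P ⊆ C} \ {insert v P} ∧
      C₃ ∈ {C | IsChamber Ω C ∧ P ⊆ C} \ {insert v P} ∧ C₂ ≠ C₃ := by
    have hmem : insert v P ∈ {C | IsChamber Ω C ∧ P ⊆ C} := ⟨hch, hPC⟩
    rw [← Set.encard_sdiff_singleton_add_one hmem] at hthree
    have h2 : (1 : ℕ∞) < ({C | IsChamber Ω C ∧ P ⊆ C} \ {insert v P}).encard := by
      by_contra hcon
      have h3 : (3 : ℕ∞) ≤ 1 + 1 := hthree.trans (by gcongr; exact not_lt.1 hcon)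
      exact absurd h3 (by decide)
    obtain ⟨C₂, C₃, h, h', hne⟩ := Set.one_lt_encard_iff.1 h2
    exact ⟨C₂, C₃, h, h', hne⟩
  -- a further chamber at the panel, in a common apartment with the given one
  have hadj : ∀ D ∈ {C | IsChamber Ω C ∧ P ⊆ C} \ {insert v P}, ∃ w, w ∉ P ∧ v ≠ w ∧
      D = insert w P ∧ ∃ L ∈ 𝒜, D ∈ L ∧ ∃ ψ : X → EuclideanSpace ℝ (Fin n), IsChart L W ψ ∧
        a v + a w = 2 * ∑ p ∈ P, b p * a p ∧ IsFoot ψ P w b := by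
    rintro D ⟨⟨hD, hPD⟩, hDne⟩
    obtain ⟨L, hL, hCL, hDL⟩ := hΩ.exists_apartment _ hCΩ D hD.1
    obtain ⟨ψ, hψ, hψφ⟩ := hΩ.exists_chart hK hL hC hCL hφ
    have hDP : D ≠ P := by
      rintro rfl
      exact hv ((hD.2 _ hCΩ hPC) ▸ Finset.mem_insert_self v D)
    obtain ⟨w, hw, hDw⟩ : ∃ w, w ∉ P ∧ D = insert w P := by
      obtain ⟨w, hwD, hwP⟩ := Finset.exists_of_ssubset (hPD.ssubset_of_ne hDP.symm)
      refine ⟨w, hwP, (Finset.eq_of_subset_of_card_le (Finset.insert_subset hwD hPD) ?_).symm⟩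
      rw [Finset.card_insert_of_notMem hwP, hcard]
      exact hψ.card_le hDL
    have hvw : v ≠ w := by
      rintro rfl
      exact hDne hDw
    have hb' : IsFoot ψ P v b := hb.congr (hψφ v (Finset.mem_insert_self v P))
      (fun p hp => hψφ p (hPC hp))
    exact ⟨w, hw, hvw, hDw, L, hL, hDL, ψ, hψ,
      hΩ.add_eq_of_adjacent hf ha hL hW hψ hP hcard hv hw hvw hCL (hDw ▸ hDL) hb'⟩
  obtain ⟨v₂, hv₂, -, rfl, L, hL, h₂L, ψ, hψ, hsum₂, hb₂⟩ := hadj C₂ hC₂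
  obtain ⟨v₃, hv₃, -, rfl, -, -, -, -, -, hsum₃, -⟩ := hadj C₃ hC₃
  -- The third pair of chambers needs its own apartment; `b` reaches it through the chamber `insert
  -- v₂ P`. The three sums then determine `a v`.
  obtain ⟨M, hM, h₂M, h₃M⟩ := hΩ.exists_apartment _ hC₂.1.1.1 _ hC₃.1.1.1
  obtain ⟨χ, hχ, hχψ⟩ := hΩ.exists_chart hL hM h₂L h₂M hψ
  have hb₂' : IsFoot χ P v₂ b := hb₂.congr (hχψ v₂ (Finset.mem_insert_self _ P))
    (fun p hp => hχψ p (Finset.mem_insert_of_mem hp))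
  have hne : v₂ ≠ v₃ := by
    rintro rfl
    exact h₂₃ rfl
  have hsum := (hΩ.add_eq_of_adjacent hf ha hM hW hχ hP hcard hv₂ hv₃ hne h₂M h₃M hb₂').1
  linarith

end Buildings

end EuclBuilding

theorem mainTheorem8 {X : Type*} (Ω : PreAbstractSimplicialComplex X)
    (𝒜 : Set (PreAbstractSimplicialComplex X))
    (hΩ : EuclBuilding.IsEuclideanBuilding Ω 𝒜) (hthick : EuclBuilding.IsThick Ω)
    (f : EuclBuilding.Realisation Ω → ℝ) (hf : EuclBuilding.IsAffineFunctional Ω 𝒜 f) :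
    ∃ c : ℝ, ∀ x : EuclBuilding.Realisation Ω, f x = c := by
  classical
  open EuclBuilding in
  suffices h : ∀ x y : Realisation Ω, f x = f y by
    rcases isEmpty_or_nonempty (Realisation Ω) with hempty | ⟨⟨y⟩⟩
    · exact ⟨0, fun x => hempty.elim x⟩
    · exact ⟨f y, fun x => h x y⟩
  intro x y
  obtain ⟨K, hK, hxK, hyK⟩ := hΩ.exists_apartment _ x.2.1 _ y.2.1
  obtain ⟨n, W, φ, hW, hφ⟩ := hΩ.apartment K hK
  have hKΩ := hΩ.subcomplex K hK
  obtain ⟨A, hA⟩ := hf.exists_affineMap hK hKΩ hW hφ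
  obtain ⟨C, hC, hcard⟩ := hφ.exists_card_eq hW.reflectionGroup
  -- The default `0` off the vertices of `Ω` is never used.
  let a : X → ℝ := fun v => if hv : {v} ∈ Ω then f (EuclBuilding.vertexPoint hv) else 0
  have ha : ∀ v (hv : {v} ∈ Ω), f (EuclBuilding.vertexPoint hv) = a v := fun v hv => by
    simp [a, hv]
  have hAa : ∀ v ∈ C, A (φ v) = a v := by
    intro v hv
    have hvK : {v} ∈ K := EuclBuilding.face_of_subset hC (by simpa using hv) (by simp)
    rw [← ha v (hKΩ hvK), hA _ (by rwa [EuclBuilding.support_vertexPoint]),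
      EuclBuilding.chartMap_vertexPoint]
  have hlin : A.linear = 0 := by
    refine EuclBuilding.linear_eq_zero_of_isFoot hcard (hφ.affineIndependent C hC) A fun v hv => ?_
    have hPcard : (C.erase v).card = n := by rw [Finset.card_erase_of_mem hv, hcard]; rfl
    -- Faces are nonempty, so panels exist only because `0 < n`.
    have hP : (C.erase v).Nonempty := Finset.card_pos.1 (hPcard ▸ hW.dim_pos)
    obtain ⟨b, hb⟩ := EuclBuilding.exists_isFoot (φ := φ) hP v
    refine ⟨b, hb, ?_⟩
    rw [hAa v hv, hΩ.eq_sum_of_isFoot hthick hf ha hK hW hφ hP hPcard (Finset.notMem_erase v C)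
      (by rwa [Finset.insert_erase hv]) hb]
    exact Finset.sum_congr rfl fun p hp => by rw [hAa p (Finset.mem_of_mem_erase hp)]
  rw [hA x hxK, hA y hyK, ← sub_eq_zero, ← vsub_eq_sub, ← A.linearMap_vsub, hlin,
    LinearMap.zero_apply]
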